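/- Let $M\in\mathbb N$, $\mathbb{R}_+^M=[0,\infty)^M$, $\mathbb{R}_{++}^M=(0,\infty)^M$, and let $\|\cdot\|$ be the Euclidean norm on $\mathbb{R}^M$. Let $\mathcal C\subset\mathbb{R}_{++}^M$ be a cone ($tx\in\mathcal C$ for all $x\in\mathcal C$, $t>0$) that is closed up to its apex, i.e. $\mathcal C\cup\{0\}$ is closed in $\mathbb{R}^M$. For each $\lambda\in\mathcal C$ let $Y=Y_\lambda$ be an $M$-dimensional random variable with independent components $Y_i\sim\mathrm{Poisson}(\lambda_i)$. For $u\in\mathbb{R}_+^M$ and $v\in\mathbb{R}_{++}^M$ put $$D_{\mathrm{KL}}(u,v)=\sum_{i=1}^M\Big(u_i\log\frac{u_i}{v_i}+v_i-u_i\Big),\qquad 0\log 0=0.$$ Let $\hat\lambda\colon\mathbb{R}_+^M\to\mathbb{R}_{++}^M$ be a function (not depending on $\lambda$) such that each component $f=\log\hat\lambda_m$, $m=1,\dots,M$, satisfies (i) $\mathbb{E}|Y_if(Y)|<\infty$ for all $i$ and all $\lambda\in\mathcal C$; (ii) $f\in C^2(\mathbb{R}_+^M)$ (with one-sided derivatives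 at the boundary); (iii) for every $j$ there are $c_j,\varepsilon_j>0$ with $|\partial_jf(y)|\le \dfrac{c_j}{\|y\|+\varepsilon_j}$ for all $y\in\mathbb{R}_+^M$; (iv) for all $k,l$ there are $c_{k,l},\varepsilon_{k,l}>0$ with $|\partial_k\partial_lf(y)|\le \dfrac{c_{k,l}}{\|y\|^2+\varepsilon_{k,l}}$ for all $y\in\mathbb{R}_+^M$. Define $$\mathrm{PAUKL}(y)=D_{\mathrm{KL}}(y,\hat\lambda(y))+\sum_{i=1}^M y_i\,\partial_i(\log\hat\lambda_i)(y)-\frac M2,\qquad y\in\mathbb{R}_+^M.$$ Then, for every $\lambda\in\mathcal C$, the variables $D_{\mathrm{KL}}(\lambda,\hat\lambda(Y))$ and $\mathrm{PAUKL}(Y)$ are integrable, and $$\mathbb{E}\,D_{\mathrm{KL}}(\lambda,\hat\lambda(Y))=\mathbb{E}\,\mathrm{PAUKL}(Y)+O\big(\|\lambda\|^{-1/2}\big)\qquad\text{as }\|\lambda\|\to+\infty\text{ in }\mathcal C.$$ -/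

import Mathlib

open Filter Asymptotics MeasureTheory ProbabilityTheory
open scoped Topology

noncomputable section

namespace PoissonRisk

/-- `ℝ^M` with its Euclidean norm. -/
abbrev Vec (M : ℕ) : Type := EuclideanSpace ℝ (Fin M)

/-- The closed nonnegative orthant `ℝ₊^M = [0, ∞)^M`. -/
def nonnegOrthant (M : ℕ) : Set (Vec M) := {y | ∀ i, 0 ≤ y i}

/-- The open positive orthant `ℝ₊₊^M = (0, ∞)^M`. -/
def posOrthant (M : ℕ) : Set (Vec M) := {y | ∀ i, 0 < y i}

/-- A vector of counts, seen as a vector of `ℝ^M`. -/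
def countVec {M : ℕ} (n : Fin M → ℕ) : Vec M := WithLp.toLp 2 (fun i => (n i : ℝ))

/-- `Y` is, under `P`, an `M`-dimensional Poisson variable with mean `lam`
and independent components. -/
structure IsPoissonVector {M : ℕ} {Ω : Type*} [MeasurableSpace Ω]
    (Y : Ω → Fin M → ℕ) (lam : Vec M) (P : Measure Ω) : Prop where
  isProbabilityMeasure : IsProbabilityMeasure P
  hasLaw : ∀ i, HasLaw (fun ω => Y ω i) (poissonMeasure (lam i).toNNReal) P
  iIndepFun : iIndepFun (fun i ω => Y ω i) P

/-- A cone `C` (stable under multiplication by positive scalars) contained in the open positive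
orthant and closed up to its apex: `C ∪ {0}` is a closed subset of `ℝ^M`. (The apex itself is not
in the open orthant, so a nonempty such `C` cannot be closed in `ℝ^M` when `M ≥ 1`.) -/
structure IsClosedPosCone {M : ℕ} (C : Set (Vec M)) : Prop where
  subset_pos : C ⊆ posOrthant M
  smul_mem : ∀ t : ℝ, 0 < t → ∀ x ∈ C, t • x ∈ C
  isClosed : IsClosed (insert 0 C)

/-- The partial derivative `∂_j f` of a function on the closed orthant `ℝ₊^M` (one-sided at the
boundary points with `y j = 0`). It depends only on the values of `f` on the orthant. -/
def partialDeriv {M : ℕ} (j : Fin M) (f : Vec M → ℝ) (y : Vec M) : ℝ :=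
  fderivWithin ℝ f (nonnegOrthant M) y (EuclideanSpace.single j 1)

/-- Hypothesis (i) of the asymptotic Stein lemma: `E |Y_i f(Y)| < ∞` for all `i`. -/
def SteinIntegrable {M : ℕ} {Ω : Type*} [MeasurableSpace Ω]
    (Y : Ω → Fin M → ℕ) (P : Measure Ω) (f : Vec M → ℝ) : Prop :=
  ∀ i, Integrable (fun ω => (Y ω i : ℝ) * f (countVec (Y ω))) P

/-- Hypotheses (ii), (iii), (iv) of the asymptotic Stein lemma: regularity of `f` on the closed
orthant and decay of its first and second partial derivatives. -/
structure SteinRegular {M : ℕ} (f : Vec M → ℝ) : Prop where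
  contDiffOn : ContDiffOn ℝ 2 f (nonnegOrthant M)
  bound_first : ∀ j, ∃ c > 0, ∃ ε > 0, ∀ y ∈ nonnegOrthant M,
    |partialDeriv j f y| ≤ c / (‖y‖ + ε)
  bound_second : ∀ k l, ∃ c > 0, ∃ ε > 0, ∀ y ∈ nonnegOrthant M,
    |partialDeriv k (partialDeriv l f) y| ≤ c / (‖y‖ ^ 2 + ε)

/-- Kullback-Leibler divergence of `u ∈ ℝ₊^M` from `v ∈ ℝ₊₊^M`
(with `0 log 0 = 0`, which holds for `Real.log`). -/
def klDivergence {M : ℕ} (u v : Vec M) : ℝ :=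
  ∑ i, (u i * Real.log (u i / v i) + v i - u i)

/-- `(y ∇) · log est(y) = ∑ i, y_i ∂_i (log est_i)(y)`. -/
def weightedDivLog {M : ℕ} (est : Vec M → Vec M) (y : Vec M) : ℝ :=
  ∑ i, y i * partialDeriv i (fun z => Real.log (est z i)) y

/-- The Poisson asymptotically unbiased Kullback-Leibler risk estimator. -/
def paukl {M : ℕ} (est : Vec M → Vec M) (y : Vec M) : ℝ :=
  klDivergence y (est y) + weightedDivLog est y - (M : ℝ) / 2

end PoissonRisk

end

/-! Write `f_i` for the logarithm of the i-th component of the estimator and `n` for the Poisson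
count vector. In the difference of the loss and PAUKL the terms `exp (f_i n)` cancel, and what is
left splits over coordinates into an entropy error `λ_i log λ_i + 1/2 - λ_i - n_i log n_i + n_i` and
a Stein error `n_i f_i(n) - λ_i f_i(n) - n_i ∂_i f_i(n)`.

The entropy error has mean `O(1/λ_i)`: polynomial bounds for `z log z` around `z = 1`, integrated at
`z = n_i/λ_i` against the exact Poisson moments, give `E[n_i log n_i] = λ_i log λ_i + 1/2 +
O(1/λ_i)` (`abs_integral_coord_mul_log_sub_le`). This is the origin of the correction `M/2`.

For the Stein error, the identity `E[n_i g(n)] = λ_i E[g(n + e_i)]` (`integral_coord_mul`) turns its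
mean into `λ_i` times the mean of a backward Taylor remainder of `f_i`. The decay of the second
derivative bounds that remainder by a multiple of `1/((n_i+1)(n_i+2))`, whose mean is at most
`1/λ_i²` by the same identity used twice. Again the result is `O(1/λ_i)`
(`SteinRegular.exists_stein_bound`).

On the cone every `λ_i` is at least a fixed multiple of `‖λ‖` (`IsClosedPosCone.exists_coord_ge`),
so the error is in fact `O(1/‖λ‖)`, which is stronger than the claimed rate. -/

namespace PoissonRisk

open scoped NNReal ENNReal

/-! ### Polynomial bounds for the logarithm and for `z log z` around 1 -/

lemma log_le_cubic {z : ℝ} (hz : 0 < z) :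
    Real.log z ≤ (z - 1) - (z - 1) ^ 2 / 2 + (z - 1) ^ 3 / 3 := by
  let k : ℝ → ℝ := fun z => Real.log z - ((z - 1) - (z - 1) ^ 2 / 2 + (z - 1) ^ 3 / 3)
  have hd : ∀ x : ℝ, 0 < x → HasDerivAt k (-((x - 1) ^ 3 / x)) x := by
    intro x hx
    have h1 : HasDerivAt (fun z : ℝ => z - 1) 1 x := (hasDerivAt_id x).sub_const 1
    have := (Real.hasDerivAt_log hx.ne').sub
      ((h1.sub ((h1.pow 2).div_const 2)).add ((h1.pow 3).div_const 3))
    convert! this using 1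
    field_simp
    push_cast
    ring
  have := isMaxOn_Ioi_of_deriv (f := k) (a := 0) (b := 1) (hd 1 one_pos).continuousAt
    (fun x hx => (hd x hx.1).differentiableAt.differentiableWithinAt)
    (fun x hx => (hd x (one_pos.trans hx)).differentiableAt.differentiableWithinAt)
    (fun x hx => by
      rw [(hd x hx.1).deriv, neg_nonneg]
      exact div_nonpos_of_nonpos_of_nonneg (Odd.pow_nonpos (by decide) (by linarith [hx.2])) hx.1.le)
    (fun x hx => by
      have hx1 : (1 : ℝ) < x := hx
      rw [(hd x (by linarith)).deriv, neg_nonpos]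
      exact div_nonneg (pow_nonneg (by linarith) 3) (by linarith))
  have h := this (show z ∈ Set.Ioi (0 : ℝ) from hz)
  simp only [k, Set.mem_ofPred_eq] at h
  norm_num at h
  linarith

lemma monotoneOn_log_sub_quadratic :
    MonotoneOn (fun z : ℝ => Real.log z - ((z - 1) - (z - 1) ^ 2 / 2)) (Set.Ioi 0) := by
  have hd : ∀ x : ℝ, 0 < x →
      HasDerivAt (fun z : ℝ => Real.log z - ((z - 1) - (z - 1) ^ 2 / 2)) ((x - 1) ^ 2 / x) x := by
    intro x hx
    have h1 : HasDerivAt (fun z : ℝ => z - 1) 1 x := (hasDerivAt_id x).sub_const 1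
    have := (Real.hasDerivAt_log hx.ne').sub (h1.sub ((h1.pow 2).div_const 2))
    convert! this using 1
    field_simp
    push_cast
    ring
  refine monotoneOn_of_deriv_nonneg (convex_Ioi 0)
    (fun x hx => (hd x hx).continuousAt.continuousWithinAt) ?_ ?_ <;> rw [interior_Ioi]
  · exact fun x hx => (hd x hx).differentiableAt.differentiableWithinAt
  · intro x hx
    rw [(hd x hx).deriv]
    exact div_nonneg (sq_nonneg _) (le_of_lt hx)

/-- The difference of the two sides has derivative `log z - ((z - 1) - (z - 1)^2 / 2)`, which is
monotone and vanishes at 1, so the difference is minimal there. -/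
lemma cubic_le_mul_log {z : ℝ} (hz : 0 ≤ z) :
    (z - 1) + (z - 1) ^ 2 / 2 - (z - 1) ^ 3 / 6 ≤ z * Real.log z := by
  rcases hz.eq_or_lt with rfl | hz
  · norm_num
  let k : ℝ → ℝ := fun z => z * Real.log z - ((z - 1) + (z - 1) ^ 2 / 2 - (z - 1) ^ 3 / 6)
  have hd : ∀ x : ℝ, 0 < x → HasDerivAt k (Real.log x - ((x - 1) - (x - 1) ^ 2 / 2)) x := by
    intro x hx
    have h1 : HasDerivAt (fun z : ℝ => z - 1) 1 x := (hasDerivAt_id x).sub_const 1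
    have := (Real.hasDerivAt_mul_log hx.ne').sub
      ((h1.add ((h1.pow 2).div_const 2)).sub ((h1.pow 3).div_const 6))
    convert! this using 1
    push_cast
    ring
  have := isMinOn_Ioi_of_deriv (f := k) (a := 0) (b := 1) (hd 1 one_pos).continuousAt
    (fun x hx => (hd x hx.1).differentiableAt.differentiableWithinAt)
    (fun x hx => (hd x (one_pos.trans hx)).differentiableAt.differentiableWithinAt)
    (fun x hx => by
      rw [(hd x hx.1).deriv]
      simpa using monotoneOn_log_sub_quadratic hx.1 (Set.mem_Ioi.2 one_pos) hx.2.le)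
    (fun x hx => by
      have hx1 : (1 : ℝ) < x := hx
      rw [(hd x (by linarith)).deriv]
      simpa using monotoneOn_log_sub_quadratic (Set.mem_Ioi.2 one_pos)
        (Set.mem_Ioi.2 (by linarith)) hx1.le)
  have h := this (show z ∈ Set.Ioi (0 : ℝ) from hz)
  simp only [k, Set.mem_ofPred_eq] at h
  norm_num at h
  linarith

lemma mul_log_le_quartic {z : ℝ} (hz : 0 ≤ z) :
    z * Real.log z ≤ (z - 1) + (z - 1) ^ 2 / 2 - (z - 1) ^ 3 / 6 + (z - 1) ^ 4 / 3 := by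
  rcases hz.eq_or_lt with rfl | hz
  · norm_num
  calc z * Real.log z ≤ z * ((z - 1) - (z - 1) ^ 2 / 2 + (z - 1) ^ 3 / 3) :=
        mul_le_mul_of_nonneg_left (log_le_cubic hz) hz.le
    _ = _ := by ring

/-! ### Unit shifts of count vectors and the product Poisson law -/

lemma exists_eq_add_single {M : ℕ} {m : Fin M → ℕ} {i : Fin M} (h : 0 < m i) :
    ∃ n : Fin M → ℕ, m = n + Pi.single i 1 := by
  refine ⟨m - Pi.single i 1, funext fun j => ?_⟩
  by_cases hj : j = i
  · subst hj
    simp only [Pi.add_apply, Pi.sub_apply, Pi.single_eq_same]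
    omega
  · simp [Pi.single_eq_of_ne hj]

/-- The law of a vector of independent Poisson variables with rates `r i`. -/
noncomputable def poissonPi {M : ℕ} (r : Fin M → ℝ≥0) : Measure (Fin M → ℕ) :=
  Measure.pi fun i => poissonMeasure (r i)

instance {M : ℕ} (r : Fin M → ℝ≥0) : IsProbabilityMeasure (poissonPi r) := by
  unfold poissonPi; infer_instance

/-! ### Stein identity, moments and integrability for Poisson laws -/

section Moments

variable {M : ℕ} (r : Fin M → ℝ≥0) (i : Fin M)

lemma poissonPi_singleton_add_single (n : Fin M → ℕ) :
    ((n i + 1 : ℕ) : ℝ≥0∞) * poissonPi r {n + Pi.single i 1} = r i * poissonPi r {n} := by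
  classical
  simp only [poissonPi, Measure.pi_singleton]
  rw [← Finset.mul_prod_erase _ _ (Finset.mem_univ i),
    ← Finset.mul_prod_erase _ (fun j => poissonMeasure (r j) {n j}) (Finset.mem_univ i),
    ← mul_assoc, ← mul_assoc]
  congr 1
  · simp only [Pi.add_apply, Pi.single_eq_same, poissonMeasure_singleton]
    rw [← ENNReal.ofReal_natCast, ← ENNReal.ofReal_coe_nnreal,
      ← ENNReal.ofReal_mul (by positivity), ← ENNReal.ofReal_mul (by positivity)]
    congr 1
    rw [Nat.factorial_succ]
    push_cast
    field_simp
    ring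
  · refine Finset.prod_congr rfl fun j hj => ?_
    simp [Pi.single_eq_of_ne (Finset.ne_of_mem_erase hj)]

/-- Stein's identity at the level of measures, checked on atoms through `(k + 1) p(k + 1) = r p(k)`.
Stating it for measures yields both the integral identity for arbitrary `g` and the transfer of
integrability. -/
lemma poissonPi_withDensity :
    (poissonPi r).withDensity (fun n => ((n i : ℝ≥0) : ℝ≥0∞)) =
      r i • (poissonPi r).map (fun n => n + Pi.single i 1) := by
  refine Measure.ext_of_singleton fun m => ?_
  rw [withDensity_apply _ (MeasurableSet.singleton _), Measure.smul_apply,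
    Measure.map_apply .of_discrete (MeasurableSet.singleton _), lintegral_singleton]
  -- Atoms with `m i = 0` carry no mass on either side: the density vanishes there, and they are not
  -- unit shifts in direction `i`.
  rcases Nat.eq_zero_or_pos (m i) with h0 | h0
  · have : (fun n : Fin M → ℕ => n + Pi.single i 1) ⁻¹' {m} = ∅ := by
      ext n
      simp only [Set.mem_preimage, Set.mem_singleton_iff, Set.mem_empty_iff_false, iff_false]
      rintro rfl
      simp at h0
    simp [this, h0]
  · obtain ⟨n, rfl⟩ := exists_eq_add_single h0
    have : (fun k : Fin M → ℕ => k + Pi.single i 1) ⁻¹' {n + Pi.single i 1} = {n} := by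
      ext k; simp
    rw [this]
    simpa [ENNReal.smul_def] using poissonPi_singleton_add_single r i n

/-- The Poisson Stein identity. -/
lemma integral_coord_mul (g : (Fin M → ℕ) → ℝ) :
    ∫ n, (n i : ℝ) * g n ∂poissonPi r = r i * ∫ n, g (n + Pi.single i 1) ∂poissonPi r := by
  have h := integral_withDensity_eq_integral_smul (μ := poissonPi r)
    (f := fun n : Fin M → ℕ => (n i : ℝ≥0)) .of_discrete g
  rw [poissonPi_withDensity, integral_smul_nnreal_measure,
    integral_map .of_discrete .of_discrete] at h
  simpa [NNReal.smul_def] using h.symm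

lemma integrable_coord_mul_iff (hr : r i ≠ 0) (g : (Fin M → ℕ) → ℝ) :
    Integrable (fun n => (n i : ℝ) * g n) (poissonPi r) ↔
      Integrable (fun n => g (n + Pi.single i 1)) (poissonPi r) := by
  have h := integrable_withDensity_iff_integrable_coe_smul (μ := poissonPi r)
    (f := fun n : Fin M → ℕ => (n i : ℝ≥0)) .of_discrete (g := g)
  rw [poissonPi_withDensity, ENNReal.smul_def,
    integrable_smul_measure (by simpa using hr) (by simp),
    integrable_map_measure .of_discrete .of_discrete] at h
  simpa [Function.comp_def] using h.symm

lemma integrable_exp_mul_poissonMeasure (s : ℝ≥0) (K : ℝ) :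
    Integrable (fun n : ℕ => Real.exp (K * n)) (poissonMeasure s) := by
  rw [integrable_poissonMeasure_iff]
  have := (Real.summable_pow_div_factorial (s * Real.exp K)).mul_left (Real.exp (-s))
  convert! this using 2 with n
  rw [Real.norm_eq_abs, Real.abs_exp, mul_comm K, Real.exp_nat_mul, mul_pow]
  ring

/-- Finiteness of all exponential moments is what makes the estimator integrable, since its
logarithm grows at most linearly. -/
lemma integrable_exp_sum_poissonPi (K : ℝ) :
    Integrable (fun n : Fin M → ℕ => Real.exp (K * ∑ i, (n i : ℝ))) (poissonPi r) := by
  have := Integrable.fintype_prod (μ := fun i => poissonMeasure (r i))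
    (f := fun (_ : Fin M) (n : ℕ) => Real.exp (K * n))
    (fun i => integrable_exp_mul_poissonMeasure (r i) K)
  simpa [poissonPi, Finset.mul_sum, Real.exp_sum] using this

lemma integrable_pow_coord (k : ℕ) :
    Integrable (fun n : Fin M → ℕ => (n i : ℝ) ^ k) (poissonPi r) := by
  refine ((integrable_exp_sum_poissonPi r 1).const_mul (k.factorial : ℝ)).mono' .of_discrete
    (.of_forall fun n => ?_)
  have h1 := Real.pow_div_factorial_le_exp (n i : ℝ) (Nat.cast_nonneg _) k
  rw [div_le_iff₀ (by positivity)] at h1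
  rw [Real.norm_of_nonneg (by positivity), mul_comm]
  refine h1.trans (mul_le_mul_of_nonneg_right (Real.exp_le_exp.2 ?_) (by positivity))
  rw [one_mul]
  exact Finset.single_le_sum (f := fun j => (n j : ℝ)) (fun j _ => Nat.cast_nonneg _)
    (Finset.mem_univ i)

lemma integrable_coord : Integrable (fun n : Fin M → ℕ => (n i : ℝ)) (poissonPi r) := by
  simpa using integrable_pow_coord r i 1

lemma integrable_quartic (a b c d e : ℝ) :
    Integrable (fun n : Fin M → ℕ => a + b * (n i : ℝ) + c * (n i : ℝ) ^ 2 + d * (n i : ℝ) ^ 3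
      + e * (n i : ℝ) ^ 4) (poissonPi r) :=
  ((((integrable_const a).add ((integrable_coord r i).const_mul b)).add
    ((integrable_pow_coord r i 2).const_mul c)).add
    ((integrable_pow_coord r i 3).const_mul d)).add ((integrable_pow_coord r i 4).const_mul e)

lemma integral_quartic_aux (a b c d e : ℝ) :
    ∫ n, (a + b * (n i : ℝ) + c * (n i : ℝ) ^ 2 + d * (n i : ℝ) ^ 3 + e * (n i : ℝ) ^ 4)
      ∂poissonPi r = a + b * (∫ n, (n i : ℝ) ∂poissonPi r) + c * (∫ n, (n i : ℝ) ^ 2 ∂poissonPi r)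
        + d * (∫ n, (n i : ℝ) ^ 3 ∂poissonPi r) + e * ∫ n, (n i : ℝ) ^ 4 ∂poissonPi r := by
  have h0 := integrable_const (μ := poissonPi r) a
  have h1 := (integrable_coord r i).const_mul b
  have h2 := (integrable_pow_coord r i 2).const_mul c
  have h3 := (integrable_pow_coord r i 3).const_mul d
  have h4 := (integrable_pow_coord r i 4).const_mul e
  have h01 : Integrable (fun n : Fin M → ℕ => a + b * (n i : ℝ)) (poissonPi r) := h0.add h1
  have h02 : Integrable (fun n : Fin M → ℕ => a + b * (n i : ℝ) + c * (n i : ℝ) ^ 2)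
    (poissonPi r) := h01.add h2
  have h03 : Integrable (fun n : Fin M → ℕ => a + b * (n i : ℝ) + c * (n i : ℝ) ^ 2
    + d * (n i : ℝ) ^ 3) (poissonPi r) := h02.add h3
  rw [integral_add h03 h4, integral_add h02 h3, integral_add h01 h2, integral_add h0 h1]
  simp only [integral_const_mul, integral_const, probReal_univ, one_smul]

lemma integral_coord : ∫ n, (n i : ℝ) ∂poissonPi r = r i := by
  simpa using integral_coord_mul r i fun _ => 1

/-- Stein's identity with `g = n_i^k` gives `E[n_i^(k+1)] = r_i E[(n_i + 1)^k]`, so each moment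
follows from the lower ones; here `k = 1`. -/
lemma integral_coord_sq : ∫ n, (n i : ℝ) ^ 2 ∂poissonPi r = (r i : ℝ) ^ 2 + r i := by
  have h := integral_coord_mul r i fun n => (n i : ℝ)
  have h' := integral_quartic_aux r i 1 1 0 0 0
  simp only [integral_coord] at h'
  calc ∫ n, (n i : ℝ) ^ 2 ∂poissonPi r = ∫ n, (n i : ℝ) * n i ∂poissonPi r := by simp only [sq]
    _ = r i * ∫ n, (1 + 1 * (n i : ℝ) + 0 * (n i : ℝ) ^ 2 + 0 * (n i : ℝ) ^ 3
        + 0 * (n i : ℝ) ^ 4) ∂poissonPi r := by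
      rw [h]; congr 1; congr 1; funext n; simp; ring
    _ = _ := by rw [h']; ring

lemma integral_coord_cube :
    ∫ n, (n i : ℝ) ^ 3 ∂poissonPi r = (r i : ℝ) ^ 3 + 3 * (r i : ℝ) ^ 2 + r i := by
  have h := integral_coord_mul r i fun n => (n i : ℝ) ^ 2
  have h' := integral_quartic_aux r i 1 2 1 0 0
  simp only [integral_coord, integral_coord_sq] at h'
  calc ∫ n, (n i : ℝ) ^ 3 ∂poissonPi r = ∫ n, (n i : ℝ) * (n i : ℝ) ^ 2 ∂poissonPi r := by
        congr 1; funext n; ring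
    _ = r i * ∫ n, (1 + 2 * (n i : ℝ) + 1 * (n i : ℝ) ^ 2 + 0 * (n i : ℝ) ^ 3
        + 0 * (n i : ℝ) ^ 4) ∂poissonPi r := by
      rw [h]; congr 1; congr 1; funext n; simp; ring
    _ = _ := by rw [h']; ring

lemma integral_coord_pow_four :
    ∫ n, (n i : ℝ) ^ 4 ∂poissonPi r =
      (r i : ℝ) ^ 4 + 6 * (r i : ℝ) ^ 3 + 7 * (r i : ℝ) ^ 2 + r i := by
  have h := integral_coord_mul r i fun n => (n i : ℝ) ^ 3
  have h' := integral_quartic_aux r i 1 3 3 1 0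
  simp only [integral_coord, integral_coord_sq, integral_coord_cube] at h'
  calc ∫ n, (n i : ℝ) ^ 4 ∂poissonPi r = ∫ n, (n i : ℝ) * (n i : ℝ) ^ 3 ∂poissonPi r := by
        congr 1; funext n; ring
    _ = r i * ∫ n, (1 + 3 * (n i : ℝ) + 3 * (n i : ℝ) ^ 2 + 1 * (n i : ℝ) ^ 3
        + 0 * (n i : ℝ) ^ 4) ∂poissonPi r := by
      rw [h]; congr 1; congr 1; funext n; simp; ring
    _ = _ := by rw [h']; ring

lemma integral_quartic (a b c d e : ℝ) :
    ∫ n, (a + b * (n i : ℝ) + c * (n i : ℝ) ^ 2 + d * (n i : ℝ) ^ 3 + e * (n i : ℝ) ^ 4)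
      ∂poissonPi r = a + b * (r i : ℝ) + c * ((r i : ℝ) ^ 2 + r i)
        + d * ((r i : ℝ) ^ 3 + 3 * (r i : ℝ) ^ 2 + r i)
        + e * ((r i : ℝ) ^ 4 + 6 * (r i : ℝ) ^ 3 + 7 * (r i : ℝ) ^ 2 + r i) := by
  rw [integral_quartic_aux, integral_coord, integral_coord_sq, integral_coord_cube,
    integral_coord_pow_four]

lemma integrable_coord_mul_log :
    Integrable (fun n : Fin M → ℕ => (n i : ℝ) * Real.log (n i)) (poissonPi r) := by
  refine (integrable_pow_coord r i 2).mono' .of_discrete (.of_forall fun n => ?_)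
  have h1 : Real.log (n i) ≤ n i := Real.log_le_self (Nat.cast_nonneg _)
  have h0 : 0 ≤ Real.log (n i : ℝ) := Real.log_natCast_nonneg _
  rw [Real.norm_of_nonneg (by positivity), sq]
  gcongr

/-- The mean of `n log n` under the Poisson law, up to `O(1 / rate)`. -/
lemma abs_integral_coord_mul_log_sub_le (hr : 1 ≤ r i) :
    |∫ n, (n i : ℝ) * Real.log (n i) ∂poissonPi r - (r i : ℝ) * Real.log (r i) - 1 / 2|
      ≤ 2 / r i := by
  set l : ℝ := (r i : ℝ) with hl
  have hl1 : 1 ≤ l := by exact_mod_cast hr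
  have hl0 : 0 < l := by linarith
  -- Rescaling by the mean `l` brings the argument of `z log z` close to 1.
  have hpt : ∀ x : ℝ, 0 ≤ x → x * Real.log x = x * Real.log l + l * (x / l * Real.log (x / l)) := by
    intro x hx
    rcases hx.eq_or_lt with rfl | hx
    · simp
    · rw [Real.log_div hx.ne' hl0.ne']; field_simp; ring
  -- With `z = n_i / l`, the moments `E[(z-1)^2] = 1/l` and `E[(z-1)^3] = 1/l^2` produce the terms
  -- `1/2` and `-1/(6l)`. The integrand below is the cubic bound expanded in powers of `n_i`.
  have lower : l * Real.log l + 1 / 2 - 1 / (6 * l) ≤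
      ∫ n, (n i : ℝ) * Real.log (n i) ∂poissonPi r := by
    calc l * Real.log l + 1 / 2 - 1 / (6 * l)
        = ∫ n, (-l / 3 + (Real.log l - 1 / 2) * (n i : ℝ) + (1 / l) * (n i : ℝ) ^ 2
          + (-1 / (6 * l ^ 2)) * (n i : ℝ) ^ 3 + 0 * (n i : ℝ) ^ 4) ∂poissonPi r := by
          rw [integral_quartic, ← hl]; field_simp; ring
      _ ≤ _ := by
        refine integral_mono (integrable_quartic ..) (integrable_coord_mul_log r i) fun n => ?_
        have h := cubic_le_mul_log (z := (n i : ℝ) / l) (by positivity)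
        have h2 := mul_le_mul_of_nonneg_left h hl0.le
        simp only [hpt (n i : ℝ) (Nat.cast_nonneg _)]
        refine le_trans (le_of_eq ?_) (add_le_add_right h2 _)
        field_simp
        ring
  -- The additional quartic term contributes `(l/3) E[(z-1)^4] = 1/l + 1/(3 l^2)`.
  have upper : ∫ n, (n i : ℝ) * Real.log (n i) ∂poissonPi r ≤
      l * Real.log l + 1 / 2 - 1 / (6 * l) + (1 / l + 1 / (3 * l ^ 2)) := by
    calc
      _ ≤ ∫ n, (0 + (Real.log l - 11 / 6) * (n i : ℝ) + (3 / l) * (n i : ℝ) ^ 2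
          + (-3 / (2 * l ^ 2)) * (n i : ℝ) ^ 3 + (1 / (3 * l ^ 3)) * (n i : ℝ) ^ 4)
          ∂poissonPi r := by
        refine integral_mono (integrable_coord_mul_log r i) (integrable_quartic ..) fun n => ?_
        have h := mul_log_le_quartic (z := (n i : ℝ) / l) (by positivity)
        have h2 := mul_le_mul_of_nonneg_left h hl0.le
        simp only [hpt (n i : ℝ) (Nat.cast_nonneg _)]
        refine le_trans (add_le_add_right h2 _) (le_of_eq ?_)
        field_simp
        ring
      _ = _ := by rw [integral_quartic, ← hl]; field_simp; ring
  have e1 : 1 / (6 * l) = 1 / 6 * (1 / l) := by ring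
  have e2 : 1 / (3 * l ^ 2) ≤ 1 / 3 * (1 / l) := by
    rw [show 1 / 3 * (1 / l) = 1 / (3 * l) by field_simp]
    exact one_div_le_one_div_of_le (by positivity) (by nlinarith)
  have e3 : 2 / l = 2 * (1 / l) := by ring
  have e4 : 0 < 1 / l := by positivity
  rw [abs_le]
  constructor <;> linarith

/-- A negative second moment bound for the Poisson law. -/
lemma integral_inv_succ_mul_le :
    (r i : ℝ) ^ 2 * ∫ n, (((n i : ℝ) + 1) * (n i + 2))⁻¹ ∂poissonPi r ≤ 1 := by
  have hb : ∀ g : (Fin M → ℕ) → ℝ, (∀ n, 0 ≤ g n) → (∀ n, g n ≤ 1) →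
      Integrable g (poissonPi r) := fun g h0 h1 =>
    (integrable_const (1 : ℝ)).mono' .of_discrete
      (.of_forall fun n => by rw [Real.norm_of_nonneg (h0 n)]; exact h1 n)
  have hle : ∀ n : Fin M → ℕ, ((n i : ℝ) + 1)⁻¹ ≤ 1 := fun n =>
    inv_le_one_of_one_le₀ (by linarith [Nat.cast_nonneg (α := ℝ) (n i)])
  have hmul : ∀ x : ℝ, 0 ≤ x → x * x⁻¹ ≤ 1 := fun x _ => mul_inv_le_one
  -- Two uses of Stein's identity, each absorbing one factor `r i`. At `n i = 0` the convention `0⁻¹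
  -- = 0` is harmless, because only upper bounds are needed.
  have h1 := integral_coord_mul r i fun n => ((n i : ℝ) * (n i + 1))⁻¹
  have h2 := integral_coord_mul r i fun n => (n i : ℝ)⁻¹
  have e1 : ∀ n : Fin M → ℕ, ((((n + Pi.single i 1 : Fin M → ℕ) i : ℕ) : ℝ) *
      (((n + Pi.single i 1 : Fin M → ℕ) i : ℕ) + 1))⁻¹ = (((n i : ℝ) + 1) * (n i + 2))⁻¹ := by
    intro n
    simp only [Pi.add_apply, Pi.single_eq_same]
    push_cast
    ring
  have e2 : ∀ n : Fin M → ℕ, (((n + Pi.single i 1 : Fin M → ℕ) i : ℕ) : ℝ)⁻¹ = ((n i : ℝ) + 1)⁻¹ := by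
    intro n; simp
  simp only [e1] at h1
  simp only [e2] at h2
  have e3 : ∀ n : Fin M → ℕ, (n i : ℝ) * ((n i : ℝ) * (n i + 1))⁻¹ ≤ ((n i : ℝ) + 1)⁻¹ := by
    intro n
    rw [mul_inv, ← mul_assoc]
    exact mul_le_of_le_one_left (by positivity) (hmul _ (Nat.cast_nonneg _))
  have i1 : ∫ n, (n i : ℝ) * ((n i : ℝ) * (n i + 1))⁻¹ ∂poissonPi r ≤
      ∫ n, ((n i : ℝ) + 1)⁻¹ ∂poissonPi r :=
    integral_mono (hb _ (fun n => by positivity) fun n => (e3 n).trans (hle n))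
      (hb _ (fun n => by positivity) hle) e3
  have i2 : ∫ n, (n i : ℝ) * (n i : ℝ)⁻¹ ∂poissonPi r ≤ 1 := by
    have := integral_mono (μ := poissonPi r) (hb (fun n => (n i : ℝ) * (n i : ℝ)⁻¹)
      (fun n => by positivity) fun n => hmul _ (Nat.cast_nonneg _)) (integrable_const (1 : ℝ))
      fun n => hmul _ (Nat.cast_nonneg _)
    simpa using this
  calc _ = (r i : ℝ) * (r i * ∫ n, (((n i : ℝ) + 1) * (n i + 2))⁻¹ ∂poissonPi r) := by ring
    _ ≤ r i * ∫ n, ((n i : ℝ) + 1)⁻¹ ∂poissonPi r := by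
      rw [← h1]; exact mul_le_mul_of_nonneg_left i1 (r i).2
    _ ≤ 1 := by rw [← h2]; exact i2

end Moments

/-! ### One-sided calculus on the closed orthant -/

section Calculus

variable {M : ℕ}

lemma convex_nonnegOrthant : Convex ℝ (nonnegOrthant M) := by
  intro x hx y hy a b ha hb _ i
  simp only [PiLp.add_apply, PiLp.smul_apply, smul_eq_mul]
  exact add_nonneg (mul_nonneg ha (hx i)) (mul_nonneg hb (hy i))

lemma isOpen_posOrthant : IsOpen (posOrthant M) := by
  have : posOrthant M = ⋂ i, {y : Vec M | 0 < y i} := by ext; simp [posOrthant]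
  rw [this]
  exact isOpen_iInter_of_finite fun i => isOpen_lt continuous_const (by fun_prop)

lemma uniqueDiffOn_nonnegOrthant : UniqueDiffOn ℝ (nonnegOrthant M) := by
  refine uniqueDiffOn_convex convex_nonnegOrthant ⟨WithLp.toLp 2 fun _ => 1, ?_⟩
  exact interior_mono (fun y hy i => (hy i).le : posOrthant M ⊆ nonnegOrthant M)
    (isOpen_posOrthant.interior_eq.symm ▸ fun _ => one_pos)

lemma add_smul_single_mem {y : Vec M} (hy : y ∈ nonnegOrthant M) (i : Fin M) {t : ℝ}
    (ht : 0 ≤ t) : y + t • EuclideanSpace.single i (1 : ℝ) ∈ nonnegOrthant M := by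
  intro j
  simp only [PiLp.add_apply, PiLp.smul_apply, PiLp.single_apply, smul_eq_mul]
  have := hy j
  split_ifs <;> linarith

/-- The derivative is taken within `[0, ∞)` because a boundary point of the orthant can only be
moved forward along a coordinate axis. -/
lemma hasDerivWithinAt_along_single {f : Vec M → ℝ} (hf : DifferentiableOn ℝ f (nonnegOrthant M))
    {y : Vec M} (hy : y ∈ nonnegOrthant M) (i : Fin M) {t : ℝ} (ht : 0 ≤ t) :
    HasDerivWithinAt (fun s : ℝ => f (y + s • EuclideanSpace.single i (1 : ℝ)))
      (partialDeriv i f (y + t • EuclideanSpace.single i (1 : ℝ))) (Set.Ici 0) t := by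
  have h1 : HasDerivWithinAt (fun s : ℝ => y + s • EuclideanSpace.single i (1 : ℝ))
      (EuclideanSpace.single i (1 : ℝ)) (Set.Ici 0) t := by
    simpa using (((hasDerivAt_id t).smul_const
      (EuclideanSpace.single i (1 : ℝ))).const_add y).hasDerivWithinAt
  exact (hf _ (add_smul_single_mem hy i ht)).hasFDerivWithinAt.comp_hasDerivWithinAt t h1
    fun s hs => add_smul_single_mem hy i hs

lemma differentiableOn_partialDeriv {f : Vec M → ℝ} (hf : ContDiffOn ℝ 2 f (nonnegOrthant M))
    (i : Fin M) : DifferentiableOn ℝ (partialDeriv i f) (nonnegOrthant M) :=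
  ((hf.fderivWithin uniqueDiffOn_nonnegOrthant (m := 1) (by norm_num)).differentiableOn
    (by norm_num)).clm_apply (differentiableOn_const _)

lemma abs_sub_le_of_partialDeriv_le {f : Vec M → ℝ}
    (hf : DifferentiableOn ℝ f (nonnegOrthant M)) {y : Vec M} (hy : y ∈ nonnegOrthant M)
    (i : Fin M) {K : ℝ} (hK : ∀ z ∈ nonnegOrthant M, |partialDeriv i f z| ≤ K) :
    |f (y + EuclideanSpace.single i (1 : ℝ)) - f y| ≤ K := by
  have := norm_image_sub_le_of_norm_deriv_le_segment' (a := (0 : ℝ)) (b := 1) (C := K)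
    (fun t ht => (hasDerivWithinAt_along_single hf hy i ht.1).mono Set.Icc_subset_Ici_self)
    (fun t ht => hK _ (add_smul_single_mem hy i ht.1)) 1 (by simp)
  simpa using this

/-- Backward first order Taylor expansion along a coordinate direction. -/
lemma abs_taylor_le {f : Vec M → ℝ} (hf : ContDiffOn ℝ 2 f (nonnegOrthant M))
    {y : Vec M} (hy : y ∈ nonnegOrthant M) (i : Fin M) {K : ℝ}
    (hK : ∀ t : ℝ, 0 ≤ t →
      |partialDeriv i (partialDeriv i f) (y + t • EuclideanSpace.single i (1 : ℝ))| ≤ K) :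
    |f (y + EuclideanSpace.single i (1 : ℝ)) - f y
      - partialDeriv i f (y + EuclideanSpace.single i (1 : ℝ))| ≤ K := by
  set e : Vec M := EuclideanSpace.single i (1 : ℝ) with he
  have hK0 : 0 ≤ K := (abs_nonneg _).trans (hK 0 le_rfl)
  have hd : ∀ t ∈ Set.Icc (0 : ℝ) 1,
      ‖partialDeriv i f (y + t • e) - partialDeriv i f (y + e)‖ ≤ K := by
    intro t ht
    have := norm_image_sub_le_of_norm_deriv_le_segment' (a := t) (b := 1) (C := K)
      (fun s hs => (hasDerivWithinAt_along_single (differentiableOn_partialDeriv hf i) hy i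
        (ht.1.trans hs.1)).mono fun x hx => ht.1.trans hx.1)
      (fun s hs => hK s (ht.1.trans hs.1)) 1 ⟨ht.2, le_rfl⟩
    rw [norm_sub_rev]
    simp only [one_smul] at this
    exact this.trans (mul_le_of_le_one_right hK0 (by linarith [ht.1]))
  -- The mean value inequality is applied a second time, after subtracting the tangent slope at the
  -- far endpoint. The expansion point is `y + e` because Stein's identity turns `n_i ∂_i f(n)` into
  -- a derivative at the shifted point.
  have := norm_image_sub_le_of_norm_deriv_le_segment' (a := (0 : ℝ)) (b := 1) (C := K)
    (f := fun t => f (y + t • e) - t * partialDeriv i f (y + e))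
    (fun t ht => ((hasDerivWithinAt_along_single (hf.differentiableOn (by norm_num)) hy i
      ht.1).mono Set.Icc_subset_Ici_self).sub
        (by simpa using (hasDerivWithinAt_id t _).mul_const (partialDeriv i f (y + e))))
    (fun t ht => hd t ⟨ht.1, ht.2.le⟩) 1 (by simp)
  simp only [one_smul, one_mul, zero_smul, add_zero, zero_mul, sub_zero, mul_one,
    Real.norm_eq_abs] at this
  rwa [sub_right_comm]

lemma countVec_mem (n : Fin M → ℕ) : countVec n ∈ nonnegOrthant M := fun _ => Nat.cast_nonneg _

lemma countVec_add_single (n : Fin M → ℕ) (i : Fin M) :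
    countVec (n + Pi.single i 1) = countVec n + EuclideanSpace.single i (1 : ℝ) := by
  ext j
  simp only [countVec, Pi.add_apply, PiLp.add_apply, PiLp.single_apply, Pi.single_apply]
  push_cast
  rfl

/-- Walking from 0 to `n` by unit coordinate steps changes `f` by at most `K` per step, and the
number of steps is the total count. -/
lemma abs_apply_countVec_le {f : Vec M → ℝ} (hf : DifferentiableOn ℝ f (nonnegOrthant M)) {K : ℝ}
    (hK : ∀ i, ∀ z ∈ nonnegOrthant M, |partialDeriv i f z| ≤ K) (n : Fin M → ℕ) :
    |f (countVec n)| ≤ |f (countVec 0)| + K * ∑ i, (n i : ℝ) := by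
  obtain ⟨N, hN⟩ : ∃ N, ∑ i, n i = N := ⟨_, rfl⟩
  induction N generalizing n with
  | zero =>
    have : n = 0 := by
      funext i
      exact Finset.sum_eq_zero_iff.1 hN i (Finset.mem_univ i)
    simp [this]
  | succ N ih =>
    obtain ⟨i, hi⟩ : ∃ i, 0 < n i := by
      by_contra! h
      rw [Finset.sum_eq_zero fun i _ => Nat.le_zero.1 (h i)] at hN
      omega
    obtain ⟨m, rfl⟩ := exists_eq_add_single hi
    have hs : ∑ j, (m + Pi.single i 1 : Fin M → ℕ) j = ∑ j, m j + 1 := by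
      simp [Finset.sum_add_distrib]
    have hs' : ∑ j, (((m + Pi.single i 1 : Fin M → ℕ) j : ℕ) : ℝ) = ∑ j, (m j : ℝ) + 1 := by
      exact_mod_cast hs
    have h1 := ih m (by omega)
    have h2 := abs_sub_le_of_partialDeriv_le hf (countVec_mem m) i (hK i)
    have h3 := abs_sub_abs_le_abs_sub (f (countVec m + EuclideanSpace.single i (1 : ℝ)))
      (f (countVec m))
    rw [hs', countVec_add_single]
    linarith

end Calculus

/-! ### Integrability and the Stein lemma for regular functions -/

namespace SteinRegular

variable {M : ℕ} {f : Vec M → ℝ}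

lemma exists_partialDeriv_le (hf : SteinRegular f) :
    ∃ K, 0 ≤ K ∧ ∀ i, ∀ z ∈ nonnegOrthant M, |partialDeriv i f z| ≤ K := by
  choose c hc ε hε h using hf.bound_first
  have hpos : ∀ i, 0 ≤ c i / ε i := fun i => (div_pos (hc i) (hε i)).le
  refine ⟨∑ i, c i / ε i, Finset.sum_nonneg fun i _ => hpos i, fun i z hz => ?_⟩
  refine ((h i z hz).trans ?_).trans
    (Finset.single_le_sum (f := fun i => c i / ε i) (fun j _ => hpos j) (Finset.mem_univ i))
  exact div_le_div_of_nonneg_left (hc i).le (hε i) (by linarith [norm_nonneg z])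

lemma exists_growth (hf : SteinRegular f) :
    ∃ a K, 0 ≤ a ∧ 0 ≤ K ∧ ∀ n, |f (countVec n)| ≤ a + K * ∑ i, (n i : ℝ) := by
  obtain ⟨K, hK0, hK⟩ := hf.exists_partialDeriv_le
  exact ⟨_, K, abs_nonneg _, hK0,
    abs_apply_countVec_le (hf.contDiffOn.differentiableOn (by norm_num)) hK⟩

lemma integrable_exp (hf : SteinRegular f) (r : Fin M → ℝ≥0) :
    Integrable (fun n => Real.exp (f (countVec n))) (poissonPi r) := by
  obtain ⟨a, K, -, -, h⟩ := hf.exists_growth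
  refine ((integrable_exp_sum_poissonPi r K).const_mul (Real.exp a)).mono' .of_discrete
    (.of_forall fun n => ?_)
  rw [Real.norm_eq_abs, Real.abs_exp, ← Real.exp_add]
  exact Real.exp_le_exp.2 ((le_abs_self _).trans (h n))

lemma integrable (hf : SteinRegular f) (r : Fin M → ℝ≥0) :
    Integrable (fun n => f (countVec n)) (poissonPi r) := by
  obtain ⟨a, K, -, -, h⟩ := hf.exists_growth
  exact ((integrable_const a).add ((integrable_finsetSum _ fun i _ =>
    integrable_coord r i).const_mul K)).mono' .of_discrete (.of_forall h)

lemma integrable_coord_mul (hf : SteinRegular f) (r : Fin M → ℝ≥0) (i : Fin M) :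
    Integrable (fun n => (n i : ℝ) * f (countVec n)) (poissonPi r) := by
  obtain ⟨a, K, ha, hK, h⟩ := hf.exists_growth
  refine ((integrable_exp_sum_poissonPi r 1).const_mul (a + 2 * K)).mono' .of_discrete
    (.of_forall fun n => ?_)
  set S := ∑ j, (n j : ℝ) with hS
  have hS0 : 0 ≤ S := Finset.sum_nonneg fun j _ => Nat.cast_nonneg _
  have hi : (n i : ℝ) ≤ S := Finset.single_le_sum (f := fun j => (n j : ℝ))
    (fun j _ => Nat.cast_nonneg _) (Finset.mem_univ i)
  have h1 : S ≤ Real.exp S := by linarith [Real.add_one_le_exp S]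
  have h2 : S ^ 2 ≤ 2 * Real.exp S := by linarith [Real.quadratic_le_exp_of_nonneg hS0]
  rw [norm_mul, Real.norm_of_nonneg (Nat.cast_nonneg _), Real.norm_eq_abs, one_mul]
  calc (n i : ℝ) * |f (countVec n)| ≤ S * (a + K * S) := by gcongr; exact h n
    _ = a * S + K * S ^ 2 := by ring
    _ ≤ a * Real.exp S + K * (2 * Real.exp S) := by gcongr
    _ = (a + 2 * K) * Real.exp S := by ring

lemma integrable_coord_mul_partialDeriv (hf : SteinRegular f) (r : Fin M → ℝ≥0) (i : Fin M) :
    Integrable (fun n => (n i : ℝ) * partialDeriv i f (countVec n)) (poissonPi r) := by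
  obtain ⟨K, hK0, hK⟩ := hf.exists_partialDeriv_le
  refine ((integrable_coord r i).mul_const K).mono' .of_discrete (.of_forall fun n => ?_)
  rw [norm_mul, Real.norm_of_nonneg (Nat.cast_nonneg _)]
  exact mul_le_mul_of_nonneg_left (hK i _ (countVec_mem n)) (Nat.cast_nonneg _)

lemma exists_taylor_bound (hf : SteinRegular f) (i : Fin M) :
    ∃ K, 0 ≤ K ∧ ∀ n : Fin M → ℕ,
      |f (countVec (n + Pi.single i 1)) - f (countVec n)
        - partialDeriv i f (countVec (n + Pi.single i 1))|
        ≤ K * (((n i : ℝ) + 1) * (n i + 2))⁻¹ := by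
  obtain ⟨c, hc, ε, hε, h⟩ := hf.bound_second i i
  -- For a natural number `k = n i` one has `k ≤ k^2`, so `(k+1)(k+2) ≤ 4k^2 + 2 ≤ (4 + 2/ε)(‖z‖^2 +
  -- ε)` whenever `k ≤ ‖z‖`.
  refine ⟨c * (4 + 2 / ε), by positivity, fun n => ?_⟩
  rw [countVec_add_single]
  refine abs_taylor_le hf.contDiffOn (countVec_mem n) i fun t ht => ?_
  have hz := add_smul_single_mem (countVec_mem n) i ht
  refine (h _ hz).trans ?_
  set z := countVec n + t • EuclideanSpace.single i (1 : ℝ) with hzdef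
  have hni : (n i : ℝ) ≤ z i := by
    simp [hzdef, countVec, ht]
  have hzn : z i ≤ ‖z‖ := (le_abs_self _).trans (PiLp.norm_apply_le z i)
  have hsq : (n i : ℝ) ^ 2 ≤ ‖z‖ ^ 2 :=
    pow_le_pow_left₀ (Nat.cast_nonneg _) (hni.trans hzn) 2
  have hnn : (n i : ℝ) ≤ (n i : ℝ) ^ 2 := by exact_mod_cast Nat.le_self_pow two_ne_zero (n i)
  rw [← div_eq_mul_inv, div_le_div_iff₀ (by positivity) (by positivity), mul_assoc]
  refine mul_le_mul_of_nonneg_left ?_ hc.le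
  have e1 : 2 / ε * ε = 2 := div_mul_cancel₀ _ hε.ne'
  have e2 : 0 ≤ 2 / ε * ‖z‖ ^ 2 := by positivity
  nlinarith

/-- The asymptotic Stein lemma for Poisson vectors. -/
lemma exists_stein_bound (hf : SteinRegular f) (i : Fin M) :
    ∃ K, 0 ≤ K ∧ ∀ r : Fin M → ℝ≥0, r i ≠ 0 →
      |∫ n, ((n i : ℝ) * f (countVec n) - r i * f (countVec n)
        - (n i : ℝ) * partialDeriv i f (countVec n)) ∂poissonPi r| ≤ K / r i := by
  obtain ⟨K, hK0, hK⟩ := hf.exists_taylor_bound i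
  refine ⟨K, hK0, fun r hr => ?_⟩
  have hr0 : (0 : ℝ) < r i := by exact_mod_cast pos_iff_ne_zero.2 hr
  have i1 := hf.integrable_coord_mul r i
  have i2 := (hf.integrable r).const_mul (r i : ℝ)
  have i3 := hf.integrable_coord_mul_partialDeriv r i
  have j1 := (integrable_coord_mul_iff r i hr _).1 i1
  have j3 := (integrable_coord_mul_iff r i hr _).1 i3
  have j12 : Integrable (fun n => f (countVec (n + Pi.single i 1)) - f (countVec n))
    (poissonPi r) := j1.sub (hf.integrable r)
  have i12 : Integrable (fun n : Fin M → ℕ => (n i : ℝ) * f (countVec n) - r i * f (countVec n))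
    (poissonPi r) := i1.sub i2
  have key : ∫ n, ((n i : ℝ) * f (countVec n) - r i * f (countVec n)
      - (n i : ℝ) * partialDeriv i f (countVec n)) ∂poissonPi r
      = r i * ∫ n, (f (countVec (n + Pi.single i 1)) - f (countVec n)
        - partialDeriv i f (countVec (n + Pi.single i 1))) ∂poissonPi r := by
    rw [integral_sub i12 i3, integral_sub i1 i2, integral_sub j12 j3,
      integral_sub j1 (hf.integrable r), integral_const_mul, integral_coord_mul r i,
      integral_coord_mul r i fun n => partialDeriv i f (countVec n)]
    ring
  have hinv : Integrable (fun n : Fin M → ℕ => (((n i : ℝ) + 1) * (n i + 2))⁻¹) (poissonPi r) :=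
    (integrable_const (1 : ℝ)).mono' .of_discrete (.of_forall fun n => by
      rw [Real.norm_of_nonneg (by positivity)]
      exact inv_le_one_of_one_le₀ (by nlinarith [Nat.cast_nonneg (α := ℝ) (n i)]))
  have hb : |∫ n, (f (countVec (n + Pi.single i 1)) - f (countVec n)
        - partialDeriv i f (countVec (n + Pi.single i 1))) ∂poissonPi r| ≤
      K * ∫ n, (((n i : ℝ) + 1) * (n i + 2))⁻¹ ∂poissonPi r := by
    rw [← integral_const_mul]
    exact norm_integral_le_of_norm_le (f := fun n => f (countVec (n + Pi.single i 1))
      - f (countVec n) - partialDeriv i f (countVec (n + Pi.single i 1)))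
      (hinv.const_mul K) (.of_forall hK)
  rw [key, abs_mul, abs_of_pos hr0, le_div_iff₀ hr0]
  have h2 := integral_inv_succ_mul_le r i
  calc _ ≤ r i * (K * ∫ n, (((n i : ℝ) + 1) * (n i + 2))⁻¹ ∂poissonPi r) * r i := by gcongr
    _ = K * ((r i : ℝ) ^ 2 * ∫ n, (((n i : ℝ) + 1) * (n i + 2))⁻¹ ∂poissonPi r) := by ring
    _ ≤ K := mul_le_of_le_one_right hK0 h2

end SteinRegular

/-! ### Law of a Poisson vector and geometry of the cone -/

/-- The law of a Poisson vector is the product of Poisson laws. -/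
lemma IsPoissonVector.hasLaw_poissonPi {M : ℕ} {Ω : Type*} [MeasurableSpace Ω]
    {Y : Ω → Fin M → ℕ} {lam : Vec M} {P : Measure Ω} (h : IsPoissonVector Y lam P) :
    HasLaw Y (poissonPi fun i => (lam i).toNNReal) P where
  aemeasurable := aemeasurable_pi_lambda _ fun i => (h.hasLaw i).aemeasurable
  map_eq := by
    have := h.isProbabilityMeasure
    have h1 := (iIndepFun_iff_map_fun_eq_pi_map fun i => (h.hasLaw i).aemeasurable).1 h.iIndepFun
    simp only [(h.hasLaw _).map_eq] at h1
    exact h1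

/-- The unit vectors of the cone form a compact set, since adding the apex to close the cone adds
nothing on the sphere. Each coordinate is positive there, hence bounded below by a positive
constant, and homogeneity extends the bound to the whole cone. -/
lemma IsClosedPosCone.exists_coord_ge {M : ℕ} {C : Set (Vec M)} (hC : IsClosedPosCone C) :
    ∃ a > 0, ∀ x ∈ C, ∀ i, a * ‖x‖ ≤ x i := by
  have hcpt : IsCompact (insert 0 C ∩ Metric.sphere 0 1) :=
    (isCompact_sphere (0 : Vec M) 1).inter_left hC.isClosed
  have hmem : ∀ x ∈ insert 0 C ∩ Metric.sphere (0 : Vec M) 1, x ∈ C := by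
    rintro x ⟨rfl | hx, h1⟩
    · simp at h1
    · exact hx
  have hi : ∀ i : Fin M, ∃ a > 0, ∀ x ∈ insert 0 C ∩ Metric.sphere (0 : Vec M) 1, a ≤ x i := by
    intro i
    obtain ⟨a, ha, h⟩ := hcpt.exists_forall_le' (f := fun x : Vec M => x i) (a := 0)
      (by fun_prop) fun x hx => hC.subset_pos (hmem x hx) i
    exact ⟨a, ha, h⟩
  choose a ha h using hi
  obtain ⟨b, hb0, hb⟩ : ∃ b > 0, ∀ i, b ≤ a i := by
    rcases isEmpty_or_nonempty (Fin M) with hM | hM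
    · exact ⟨1, one_pos, fun i => hM.elim i⟩
    · obtain ⟨j, hj⟩ := Finite.exists_min a
      exact ⟨a j, ha j, hj⟩
  refine ⟨b, hb0, fun x hx i => ?_⟩
  have hx0 : x ≠ 0 := by
    rintro rfl
    simpa using hC.subset_pos hx i
  have hn : 0 < ‖x‖ := norm_pos_iff.2 hx0
  have h1 := h i (‖x‖⁻¹ • x) ⟨Or.inr (hC.smul_mem _ (inv_pos.2 hn) x hx), by
    simp [norm_smul, hn.ne']⟩
  simp only [PiLp.smul_apply, smul_eq_mul] at h1
  have h2 := (hb i).trans h1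
  rw [inv_mul_eq_div, le_div_iff₀ hn] at h2
  exact h2

/-! ### Comparison of the risk with the mean of PAUKL -/

section Risk

variable {M : ℕ} {est : Vec M → Vec M}

lemma mul_log_div {x y : ℝ} (hy : y ≠ 0) :
    x * Real.log (x / y) = x * Real.log x - x * Real.log y := by
  rcases eq_or_ne x 0 with rfl | hx
  · simp
  · rw [Real.log_div hx hy, mul_sub]

lemma klDivergence_est (hest : ∀ y ∈ nonnegOrthant M, est y ∈ posOrthant M) (u : Vec M)
    (n : Fin M → ℕ) :
    klDivergence u (est (countVec n)) = ∑ i, (u i * Real.log (u i)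
      - u i * Real.log (est (countVec n) i) + Real.exp (Real.log (est (countVec n) i)) - u i) := by
  refine Finset.sum_congr rfl fun i _ => ?_
  have hpos := hest _ (countVec_mem n) i
  rw [mul_log_div hpos.ne', Real.exp_log hpos]

lemma integrable_klDivergence (hest : ∀ y ∈ nonnegOrthant M, est y ∈ posOrthant M)
    (hreg : ∀ i, SteinRegular fun y => Real.log (est y i)) (r : Fin M → ℝ≥0) (u : Vec M) :
    Integrable (fun n => klDivergence u (est (countVec n))) (poissonPi r) := by
  simp only [klDivergence_est hest]
  exact integrable_finsetSum _ fun i _ => (((integrable_const _).sub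
    (((hreg i).integrable r).const_mul (u i))).add ((hreg i).integrable_exp r)).sub
      (integrable_const _)

lemma integrable_paukl (hest : ∀ y ∈ nonnegOrthant M, est y ∈ posOrthant M)
    (hreg : ∀ i, SteinRegular fun y => Real.log (est y i)) (r : Fin M → ℝ≥0) :
    Integrable (fun n => paukl est (countVec n)) (poissonPi r) := by
  simp only [paukl, klDivergence_est hest, weightedDivLog]
  exact ((integrable_finsetSum _ fun i _ => (((integrable_coord_mul_log r i).sub
    ((hreg i).integrable_coord_mul r i)).add ((hreg i).integrable_exp r)).sub
      (integrable_coord r i)).add (integrable_finsetSum _ fun i _ =>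
        (hreg i).integrable_coord_mul_partialDeriv r i)).sub (integrable_const _)

/-- The entropy part `A i` costs `2 / lam i` and the Stein part `B i` costs `K i / lam i`. The
threshold 1 on the rates is the one required by the entropy estimate. -/
lemma exists_risk_bound (hest : ∀ y ∈ nonnegOrthant M, est y ∈ posOrthant M)
    (hreg : ∀ i, SteinRegular fun y => Real.log (est y i)) :
    ∃ K : Fin M → ℝ, (∀ i, 0 ≤ K i) ∧ ∀ lam : Vec M, (∀ i, 1 ≤ lam i) →
      |(∫ n, klDivergence lam (est (countVec n)) ∂poissonPi fun i => (lam i).toNNReal)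
        - ∫ n, paukl est (countVec n) ∂poissonPi fun i => (lam i).toNNReal|
        ≤ ∑ i, K i / lam i := by
  choose K hK0 hK using fun i => (hreg i).exists_stein_bound i
  refine ⟨fun i => 2 + K i, fun i => by linarith [hK0 i], fun lam hlam => ?_⟩
  set r : Fin M → ℝ≥0 := fun i => (lam i).toNNReal
  have hrl : ∀ i, (r i : ℝ) = lam i := fun i => Real.coe_toNNReal _ (by linarith [hlam i])
  have hr1 : ∀ i, 1 ≤ r i := fun i => by
    rw [← NNReal.coe_le_coe, hrl]; exact hlam i
  let A : Fin M → (Fin M → ℕ) → ℝ := fun i n =>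
    lam i * Real.log (lam i) + 1 / 2 - lam i - (n i : ℝ) * Real.log (n i) + n i
  let B : Fin M → (Fin M → ℕ) → ℝ := fun i n =>
    (n i : ℝ) * Real.log (est (countVec n) i) - r i * Real.log (est (countVec n) i)
      - (n i : ℝ) * partialDeriv i (fun y => Real.log (est y i)) (countVec n)
  have hA : ∀ i, Integrable (A i) (poissonPi r) := fun i =>
    ((integrable_const _).sub (integrable_coord_mul_log r i)).add (integrable_coord r i)
  have hB : ∀ i, Integrable (B i) (poissonPi r) := fun i =>
    (((hreg i).integrable_coord_mul r i).sub (((hreg i).integrable r).const_mul _)).sub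
      ((hreg i).integrable_coord_mul_partialDeriv r i)
  have hAint : ∀ i, |∫ n, A i n ∂poissonPi r| ≤ 2 / lam i := by
    intro i
    have h := abs_integral_coord_mul_log_sub_le r i (hr1 i)
    have h0 : Integrable (fun n : Fin M → ℕ => lam i * Real.log (lam i) + 1 / 2 - lam i
      - (n i : ℝ) * Real.log (n i)) (poissonPi r) :=
      (integrable_const _).sub (integrable_coord_mul_log r i)
    have : ∫ n, A i n ∂poissonPi r = -(∫ n, (n i : ℝ) * Real.log (n i) ∂poissonPi r
        - (r i : ℝ) * Real.log (r i) - 1 / 2) := by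
      simp only [A]
      rw [integral_add h0 (integrable_coord r i),
        integral_sub (integrable_const _) (integrable_coord_mul_log r i), integral_coord,
        integral_const, probReal_univ, one_smul, hrl]
      ring
    rwa [this, abs_neg, ← hrl]
  have hpt : ∀ n, klDivergence lam (est (countVec n)) - paukl est (countVec n)
      = ∑ i, (A i n + B i n) := by
    intro n
    -- Each coordinate receives its own `1/2`, which compensates the entropy bias.
    have hM : (M : ℝ) / 2 = ∑ i : Fin M, (1 / 2 : ℝ) := by simp; ring
    rw [paukl, klDivergence_est hest, klDivergence_est hest, weightedDivLog, hM,
      ← Finset.sum_add_distrib, ← Finset.sum_sub_distrib, ← Finset.sum_sub_distrib]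
    refine Finset.sum_congr rfl fun i _ => ?_
    simp only [A, B, hrl]
    simp only [show (countVec n : Vec M) i = (n i : ℝ) from rfl]
    ring
  rw [← integral_sub (integrable_klDivergence hest hreg r lam) (integrable_paukl hest hreg r)]
  simp only [hpt]
  have hAB : ∀ i, Integrable (fun n => A i n + B i n) (poissonPi r) :=
    fun i => (hA i).add (hB i)
  rw [integral_finsetSum _ fun i _ => hAB i]
  refine (Finset.abs_sum_le_sum_abs _ _).trans (Finset.sum_le_sum fun i _ => ?_)
  rw [integral_add (hA i) (hB i), add_div]
  refine (abs_add_le _ _).trans (add_le_add (hAint i) ?_)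
  rw [← hrl]
  exact hK i r (by have := hr1 i; positivity)

end Risk

end PoissonRisk

/-! ### The main theorem -/

theorem mainTheorem1 {M : ℕ} {Ω : Type*} [MeasurableSpace Ω]
    (C : Set (PoissonRisk.Vec M)) (hC : PoissonRisk.IsClosedPosCone C)
    (P : PoissonRisk.Vec M → Measure Ω) (Y : PoissonRisk.Vec M → Ω → Fin M → ℕ)
    (hY : ∀ lam ∈ C, PoissonRisk.IsPoissonVector (Y lam) lam (P lam))
    (est : PoissonRisk.Vec M → PoissonRisk.Vec M)
    (hest : ∀ y ∈ PoissonRisk.nonnegOrthant M, est y ∈ PoissonRisk.posOrthant M)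
    (hint : ∀ lam ∈ C, ∀ i,
      PoissonRisk.SteinIntegrable (Y lam) (P lam) (fun y => Real.log (est y i)))
    (hreg : ∀ i, PoissonRisk.SteinRegular (fun y => Real.log (est y i))) :
    (∀ lam ∈ C,
      Integrable (fun ω => PoissonRisk.klDivergence lam
        (est (PoissonRisk.countVec (Y lam ω)))) (P lam) ∧
      Integrable (fun ω => PoissonRisk.paukl est (PoissonRisk.countVec (Y lam ω))) (P lam)) ∧
    (fun lam : PoissonRisk.Vec M =>
      (∫ ω, PoissonRisk.klDivergence lam (est (PoissonRisk.countVec (Y lam ω))) ∂(P lam)) -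
        ∫ ω, PoissonRisk.paukl est (PoissonRisk.countVec (Y lam ω)) ∂(P lam))
      =O[comap (fun lam : PoissonRisk.Vec M => ‖lam‖) atTop ⊓ 𝓟 C]
        (fun lam => ‖lam‖ ^ (-(1 / 2) : ℝ)) := by
  have hlaw : ∀ lam ∈ C, ProbabilityTheory.HasLaw (Y lam)
      (PoissonRisk.poissonPi fun i => (lam i).toNNReal) (P lam) :=
    fun lam hlam => (hY lam hlam).hasLaw_poissonPi
  have hintegrable : ∀ lam ∈ C, ∀ g : (Fin M → ℕ) → ℝ,
      Integrable g (PoissonRisk.poissonPi fun i => (lam i).toNNReal) →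
      Integrable (fun ω => g (Y lam ω)) (P lam) := by
    intro lam hlam g hg
    rw [← (hlaw lam hlam).map_eq] at hg
    exact (integrable_map_measure .of_discrete (hlaw lam hlam).aemeasurable).1 hg
  have hintegral : ∀ lam ∈ C, ∀ g : (Fin M → ℕ) → ℝ,
      ∫ ω, g (Y lam ω) ∂(P lam) =
        ∫ n, g n ∂(PoissonRisk.poissonPi fun i => (lam i).toNNReal) := by
    intro lam hlam g
    rw [← (hlaw lam hlam).map_eq, integral_map (hlaw lam hlam).aemeasurable .of_discrete]
  refine ⟨fun lam hlam => ⟨hintegrable lam hlam _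
    (PoissonRisk.integrable_klDivergence hest hreg _ lam), hintegrable lam hlam _
    (PoissonRisk.integrable_paukl hest hreg _)⟩, ?_⟩
  obtain ⟨a, ha, hcone⟩ := hC.exists_coord_ge
  obtain ⟨K, hK0, hK⟩ := PoissonRisk.exists_risk_bound hest hreg
  refine IsBigO.of_bound (∑ i, K i / a) ?_
  -- The bound `1 / a` forces every rate to be at least 1; the bound 1 lets the exponent `-1` be
  -- weakened to `-1/2` at the end.
  have hlarge : ∀ᶠ lam : PoissonRisk.Vec M in comap (fun lam => ‖lam‖) atTop ⊓ 𝓟 C,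
      max 1 (1 / a) ≤ ‖lam‖ ∧ lam ∈ C :=
    ((tendsto_comap.eventually (eventually_ge_atTop _)).filter_mono inf_le_left).and
      (mem_inf_of_right (mem_principal_self C))
  filter_upwards [hlarge] with lam ⟨hn, hlam⟩
  have h1 : 1 ≤ ‖lam‖ := (le_max_left _ _).trans hn
  have h2 : 1 ≤ a * ‖lam‖ := by
    have := (le_max_right _ _).trans hn
    rwa [div_le_iff₀ ha, mul_comm] at this
  have h3 : 0 < ‖lam‖ := by linarith
  rw [hintegral lam hlam fun n => PoissonRisk.klDivergence lam (est (PoissonRisk.countVec n)),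
    hintegral lam hlam fun n => PoissonRisk.paukl est (PoissonRisk.countVec n),
    Real.norm_of_nonneg (Real.rpow_nonneg h3.le _)]
  calc _ ≤ ∑ i, K i / lam i := hK lam fun i => h2.trans (hcone lam hlam i)
    _ ≤ ∑ i, K i / (a * ‖lam‖) := Finset.sum_le_sum fun i _ =>
      div_le_div_of_nonneg_left (hK0 i) (by positivity) (hcone lam hlam i)
    _ = (∑ i, K i / a) * ‖lam‖ ^ (-1 : ℝ) := by
      rw [Finset.sum_mul, Real.rpow_neg_one]
      exact Finset.sum_congr rfl fun i _ => by rw [← div_div, div_eq_mul_inv _ ‖lam‖]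
    _ ≤ _ := mul_le_mul_of_nonneg_left (Real.rpow_le_rpow_of_exponent_le h1 (by norm_num))
      (Finset.sum_nonneg fun i _ => div_nonneg (hK0 i) ha.le)
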